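/- **Setting.** Let $\mathcal M$ be a structural causal model with finitely many endogenous variables $x_1,\dots,x_n$, mutually independent exogenous variables $e_1,\dots,e_n$ with laws $P_{e_1},\dots,P_{e_n}$, and measurable structural equations $x_i=f_i\big((x_k)_{k\ne i},(e_k)_k\big)$. A variable $z$ is an *SCM-parent* of $x_i$ if there is no function $\tilde f_i$ of the variables other than $x_i$ and $z$ such that the equations $x_i=f_i(\cdot)$ and $x_i=\tilde f_i(\cdot)$ are equivalent (for all values of the variables). Assume that $e_i$ is the only exogenous SCM-parent of $x_i$, for every $i$, and that the graph $\mathcal G_{\mathcal M}$ on $\{x_1,\dots,x_n\}$ with edges $x_j\to x_i$ for $x_j$ an SCM-parent of $x_i$ is acyclic. For a directed graph, the Markov blanket of a node is the set of its parents, its children, and the other parents of its children. For a DAG $\mathcal G$ on $\{x_1,\dots,x_n\}$, the augmented graph $\mathcal G^a$ is $\mathcal G$ together with the nodes $e_1,\dots,e_n$ and the edges $e_i\to x_i$. Let $MB_i(\mathcal G)$ be the Markov blanket of $x_i$ in $\mathcal G$, and $MB^e_i(\mathcal G)$ the set of endogenous nodes in the Markov blanket of $e_i$ in $\mathcal G^a$.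 **Theorem.** (a) For all $i\neq j$: $x_j\in MB^e_i(\mathcal G_{\mathcal M})$ if and only if $x_j$ is an SCM-parent of $x_i$. Moreover, for all $i$, $MB_i(\mathcal G_{\mathcal M})\cap MB^e_i(\mathcal G_{\mathcal M})$ is exactly the set of endogenous SCM-parents of $x_i$. (b) Let the variables be realized as random variables on a standard Borel probability space, the $e_k$ being independent with laws $P_{e_k}$ and the structural equations holding. Suppose that the model is faithful in the following sense: whenever $e_i\perp\!\!\!\perp x_j\mid Z$ for a set $Z$ of endogenous variables with $x_j\notin Z$, the nodes $e_i$ and $x_j$ are d-separated by $Z$ in $\mathcal G_{\mathcal M}^a$. Let $\mathcal G$ be any DAG on $\{x_1,\dots,x_n\}$ whose augmented graph represents these independencies, i.e. for all $i,j$ and all such $Z$, $e_i\perp\!\!\!\perp x_j\mid Z$ holds if and only if $e_i$ and $x_j$ are d-separated by $Z$ in $\mathcal G^a$. Then, for all $i\ne j$, $x_j\in MB^e_i(\mathcal G)$ if and only if $x_j$ is an SCM-parent of $x_i$; and for all $i$, $MB_i(\mathcal G)\cap MB^e_i(\mathcal G)$ is exactly the set of endogenous SCM-parents of $x_i$. 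-/

import Mathlib

open MeasureTheory ProbabilityTheory

universe u v w

namespace CausalGraph

variable {V : Type*}

/-- `x₀ → x₁ → ... → x₀` never happens. -/
def IsDAG (G : Digraph V) : Prop := ∀ x, ¬ Relation.TransGen G.Adj x x

def parents (G : Digraph V) (x : V) : Set V := {y | G.Adj y x}

def children (G : Digraph V) (x : V) : Set V := {y | G.Adj x y}

/-- The other parents of the children of `x`. -/
def spouses (G : Digraph V) (x : V) : Set V := {y | y ≠ x ∧ ∃ z, G.Adj x z ∧ G.Adj y z}

def markovBlanket (G : Digraph V) (x : V) : Set V := children G x ∪ parents G x ∪ spouses G x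

/-- `p 0, ..., p n` is a trail: consecutive nodes are joined by an edge in one of the two
directions. Nodes may be repeated. -/
def IsTrail (G : Digraph V) (n : ℕ) (p : ℕ → V) : Prop :=
  ∀ k < n, G.Adj (p k) (p (k + 1)) ∨ G.Adj (p (k + 1)) (p k)

/-- The `k`-th position of the trail `p 0, ..., p n` is the middle of a V-structure. -/
def IsCollider (G : Digraph V) (n : ℕ) (p : ℕ → V) (k : ℕ) : Prop :=
  0 < k ∧ k < n ∧ G.Adj (p (k - 1)) (p k) ∧ G.Adj (p (k + 1)) (p k)

/-- The trail is active given `C`: every collider lies in `C`, and no other position does.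
Since trails may repeat nodes, a collider outside `C` that has a descendant in `C` is passed by
walking down to that descendant and back, so this gives the usual d-separation. -/
def IsActiveTrail (G : Digraph V) (C : Set V) (n : ℕ) (p : ℕ → V) : Prop :=
  IsTrail G n p ∧ ∀ k ≤ n, (p k ∈ C ↔ IsCollider G n p k)

/-- `A` and `B` are d-separated given `C`. -/
def DSep (G : Digraph V) (A B C : Set V) : Prop :=
  ∀ x ∈ A, ∀ y ∈ B, ¬ ∃ (n : ℕ) (p : ℕ → V), p 0 = x ∧ p n = y ∧ IsActiveTrail G C n p

/-- The augmented graph on the endogenous nodes `x_i = Sum.inl i` and the exogenous nodes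
`e_i = Sum.inr i`: the edges of `G` together with `e_i → x_i` for every `i`. -/
def augmented {ι : Type*} (G : Digraph ι) : Digraph (ι ⊕ ι) where
  Adj a b :=
    match a, b with
    | .inl i, .inl j => G.Adj i j
    | .inr i, .inl j => i = j
    | _, .inr _ => False

/-- The Markov blanket of the exogenous node `e_i` in the augmented graph, restricted to the
endogenous nodes. -/
def exoMarkovBlanket {ι : Type*} (G : Digraph ι) (i : ι) : Set ι :=
  {j | Sum.inl j ∈ markovBlanket (augmented G) (Sum.inr i)}

end CausalGraph

/-- A structural causal model with endogenous variables indexed by `X` and exogenous variables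
indexed by `Y`. The exogenous variables are independent, so their joint law is given by the
marginals `P e`. -/
structure SCM (X : Type u) (Y : Type v) where
  /-- codomain of an endogenous variable -/
  DX : X → Type w
  /-- codomain of an exogenous variable -/
  DY : Y → Type w
  measX : ∀ x, MeasurableSpace (DX x)
  measY : ∀ e, MeasurableSpace (DY e)
  /-- the structural function of `x`, a function of all the other variables -/
  f : ∀ x, (∀ y : {y : X // y ≠ x}, DX y.1) → (∀ e, DY e) → DX x
  measurable_f : ∀ x, Measurable
    fun a : (∀ y : {y : X // y ≠ x}, DX y.1) × (∀ e, DY e) => f x a.1 a.2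
  /-- the law of an exogenous variable -/
  P : ∀ e, Measure (DY e)
  isProb : ∀ e, IsProbabilityMeasure (P e)

attribute [instance] SCM.measX SCM.measY SCM.isProb

namespace SCM

variable {X : Type u} {Y : Type v}

/-- `z` is a parent of the endogenous variable `x`: the equation of `x` cannot be rewritten as an
equivalent equation in which `z` does not occur. -/
def IsParent (M : SCM.{u, v, w} X Y) (z : X ⊕ Y) (x : X) : Prop :=
  ¬ ∃ f' : (∀ y : {y : X // y ≠ x ∧ Sum.inl y ≠ z}, M.DX y.1) →
      (∀ e : {e : Y // Sum.inr e ≠ z}, M.DY e.1) → M.DX x,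
    ∀ (a : M.DX x) (xs : ∀ y : {y : X // y ≠ x}, M.DX y.1) (es : ∀ e, M.DY e),
      a = M.f x xs es ↔ a = f' (fun y => xs ⟨y.1, y.2.1⟩) (fun e => es e.1)

/-- The graph on the endogenous variables formed by the parent relation of the model. -/
def graph (M : SCM.{u, v, w} X Y) : Digraph X where
  Adj y x := M.IsParent (Sum.inl y) x

/-- Every endogenous variable `x_i` has exactly one exogenous parent, namely `e_i`. -/
def HasMatchedExogenous {ι : Type u} (M : SCM.{u, u, w} ι ι) : Prop :=
  ∀ i k : ι, M.IsParent (Sum.inr k) i ↔ k = i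

/-- Random variables that realize the model: the exogenous ones are independent with the
prescribed laws, and the endogenous ones solve the structural equations. -/
structure Solution (M : SCM.{u, v, w} X Y) {Ω : Type*} [MeasurableSpace Ω]
    (μ : Measure Ω) where
  x : ∀ i, Ω → M.DX i
  e : ∀ k, Ω → M.DY k
  measurable_x : ∀ i, Measurable (x i)
  measurable_e : ∀ k, Measurable (e k)
  indep : iIndepFun e μ
  law : ∀ k, μ.map (e k) = M.P k
  eqn : ∀ i ω, x i ω = M.f i (fun y => x y.1 ω) (fun k => e k ω)

namespace Solution

variable {ι : Type u} {M : SCM.{u, u, w} ι ι} {Ω : Type*} [MeasurableSpace Ω] {μ : Measure Ω}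

theorem comap_le (S : M.Solution μ) (Z : Set ι) :
    MeasurableSpace.comap (fun ω (k : Z) => S.x k.1 ω) inferInstance ≤ ‹MeasurableSpace Ω› :=
  (measurable_pi_lambda _ fun k : Z => S.measurable_x k.1).comap_le

variable [StandardBorelSpace Ω] [IsFiniteMeasure μ]

/-- The exogenous variable `e_i` and the endogenous variable `x_j` are conditionally independent
given the endogenous variables `x_k`, `k ∈ Z`. -/
def CondIndep (S : M.Solution μ) (i j : ι) (Z : Set ι) : Prop :=
  CondIndepFun (MeasurableSpace.comap (fun ω (k : Z) => S.x k.1 ω) inferInstance)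
    (S.comap_le Z) (S.e i) (S.x j) μ

/-- Every conditional independence between an exogenous and an endogenous variable, given
endogenous variables, is a d-separation in the augmented graph of `G`. -/
def IsFaithfulTo (S : M.Solution μ) (G : Digraph ι) : Prop :=
  ∀ (i j : ι) (Z : Set ι), j ∉ Z → S.CondIndep i j Z →
    CausalGraph.DSep (CausalGraph.augmented G) {Sum.inr i} {Sum.inl j} (Sum.inl '' Z)

/-- The conditional independencies between an exogenous and an endogenous variable, given
endogenous variables, are exactly the d-separations in the augmented graph of `G`. -/
def IsRepresentedBy (S : M.Solution μ) (G : Digraph ι) : Prop :=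
  ∀ (i j : ι) (Z : Set ι), j ∉ Z → (S.CondIndep i j Z ↔
    CausalGraph.DSep (CausalGraph.augmented G) {Sum.inr i} {Sum.inl j} (Sum.inl '' Z))

end Solution

end SCM

/-! In the augmented graph `e_i` has no parents and the single child `x_i`, so its Markov blanket is
`x_i` with the parents of `x_i`. Both claims about blankets thus follow once the edges of the graph
are those of the parent relation; in (a) this is the definition.

For (b), the conditioning set of all endogenous nodes except `x_j` detects edges: it d-separates
`e_i` from `x_j` exactly when `x_j → x_i` is absent (`IsDAG.dSep_augmented_compl`). A non-edge of
`G` gives an independence, hence a non-edge of the model by faithfulness. Conversely, a non-edge of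
the model must yield an independence, which is proved from the structural equations
(`condIndep_compl_of_not_adj`). Let `U` be the parents of `x_i` and `F` the noises other than `e_i`.
Then `U` is a function of `F`, and `x_i` of `U` and `e_i`, so `e_i` and `F` are independent given
`(U, x_i)`. Every endogenous variable is a function of `x_i` and `F`, so the others add nothing
about `e_i` once `U` and `x_i` are known. -/

theorem MeasurableSpace.comap_pi_le_iff {Ω κ : Type*} {α : κ → Type*}
    [∀ k, MeasurableSpace (α k)] {m : MeasurableSpace Ω} {f : ∀ k, Ω → α k} :
    MeasurableSpace.comap (fun ω k => f k ω) inferInstance ≤ m ↔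
      ∀ k, MeasurableSpace.comap (f k) inferInstance ≤ m := by
  simp only [← measurable_iff_comap_le, measurable_pi_iff]

/-! ### Conditional independence through conditional expectations. -/

section CondExp

variable {Ω : Type*} {m₁ m₂ n n' n'' mE mF mU mX m₀ : MeasurableSpace Ω} {μ : Measure Ω}

theorem MeasurableSpace.sup_eq_generateFrom_inter :
    m₁ ⊔ m₂ = MeasurableSpace.generateFrom
      {s | ∃ t u, MeasurableSet[m₁] t ∧ MeasurableSet[m₂] u ∧ t ∩ u = s} := by
  refine le_antisymm (sup_le (fun t ht => ?_) fun u hu => ?_)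
    (MeasurableSpace.generateFrom_le ?_)
  · exact MeasurableSpace.measurableSet_generateFrom
      ⟨t, Set.univ, ht, MeasurableSet.univ, Set.inter_univ t⟩
  · exact MeasurableSpace.measurableSet_generateFrom
      ⟨Set.univ, u, MeasurableSet.univ, hu, Set.univ_inter u⟩
  · rintro _ ⟨t, u, ht, hu, rfl⟩
    exact MeasurableSet.inter (le_sup_left (a := m₁) (b := m₂) t ht)
      (le_sup_right (a := m₁) (b := m₂) u hu)

/-- A π-λ argument: the sets `t ∩ u` form a π-system generating `m₁ ⊔ m₂`. -/
theorem setIntegral_eq_of_forall_inter (h₁ : m₁ ≤ m₀) (h₂ : m₂ ≤ m₀) {f g : Ω → ℝ}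
    (hf : Integrable f μ) (hg : Integrable g μ)
    (h : ∀ t u, MeasurableSet[m₁] t → MeasurableSet[m₂] u →
      ∫ ω in t ∩ u, f ω ∂μ = ∫ ω in t ∩ u, g ω ∂μ) (s : Set Ω)
    (hs : MeasurableSet[m₁ ⊔ m₂] s) : ∫ ω in s, f ω ∂μ = ∫ ω in s, g ω ∂μ := by
  have hle : m₁ ⊔ m₂ ≤ m₀ := sup_le h₁ h₂
  have huniv : ∫ ω, f ω ∂μ = ∫ ω, g ω ∂μ := by
    simpa using h Set.univ Set.univ MeasurableSet.univ MeasurableSet.univ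
  induction s, hs using MeasurableSpace.induction_on_inter
    (MeasurableSpace.sup_eq_generateFrom_inter (m₁ := m₁) (m₂ := m₂)) with
  | h_inter =>
    rintro _ ⟨t, u, ht, hu, rfl⟩ _ ⟨t', u', ht', hu', rfl⟩ -
    exact ⟨t ∩ t', u ∩ u', ht.inter ht', hu.inter hu', Set.inter_inter_inter_comm t t' u u'⟩
  | empty => simp
  | basic s hs =>
    obtain ⟨t, u, ht, hu, rfl⟩ := hs
    exact h t u ht hu
  | compl s hs ih =>
    have hf' := integral_add_compl (hle s hs) hf
    have hg' := integral_add_compl (hle s hs) hg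
    linarith
  | iUnion s hd hs ih =>
    rw [integral_iUnion (fun k => hle _ (hs k)) hd hf.integrableOn,
      integral_iUnion (fun k => hle _ (hs k)) hd hg.integrableOn]
    exact tsum_congr ih

variable [IsFiniteMeasure μ]

theorem integrable_indicator_one {s : Set Ω} (hs : MeasurableSet s) :
    Integrable (s.indicator fun _ => (1 : ℝ)) μ :=
  (integrable_const 1).indicator hs

theorem setIntegral_mul_condExp_indicator (hn : n ≤ m₀) {C B : Set Ω} (hC : MeasurableSet[n] C)
    (hB : MeasurableSet B) {g : Ω → ℝ} (hg : StronglyMeasurable[n] g) (hgi : Integrable g μ) :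
    ∫ ω in C, g ω * (μ⟦B | n⟧) ω ∂μ = ∫ ω in C ∩ B, g ω ∂μ := by
  have heq : (g * B.indicator fun _ => (1 : ℝ)) = B.indicator g := by
    ext ω
    by_cases hω : ω ∈ B <;> simp [hω]
  have hint : Integrable (g * B.indicator fun _ => (1 : ℝ)) μ := heq ▸ hgi.indicator hB
  have h := condExp_mul_of_stronglyMeasurable_left hg hint (integrable_indicator_one hB)
  rw [← setIntegral_indicator hB, ← heq, ← setIntegral_condExp hn hint hC]
  exact (setIntegral_congr_ae (hn C hC) (h.mono fun ω hω _ => hω)).symm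

/-- Conditional independence, expressed by invariance of conditional probabilities when the
conditioning σ-algebra is enlarged, is symmetric. -/
theorem condExp_sup_eq_symm (hn : n ≤ m₀) (hE : mE ≤ m₀) (hF : mF ≤ m₀)
    (h : ∀ B, MeasurableSet[mF] B → μ⟦B | n ⊔ mE⟧ =ᵐ[μ] μ⟦B | n⟧)
    {A : Set Ω} (hA : MeasurableSet[mE] A) : μ⟦A | n ⊔ mF⟧ =ᵐ[μ] μ⟦A | n⟧ := by
  have hm : StronglyMeasurable[n ⊔ mF] (μ⟦A | n⟧) := stronglyMeasurable_condExp.mono le_sup_left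
  refine (ae_eq_condExp_of_forall_setIntegral_eq (sup_le hn hF)
    (integrable_indicator_one (hE A hA)) (fun s _ _ => integrable_condExp.integrableOn)
    (fun s hs _ => setIntegral_eq_of_forall_inter hn hF integrable_condExp
      (integrable_indicator_one (hE A hA)) ?_ s hs)
    hm.aestronglyMeasurable).symm
  intro C B hC hB
  have hCA : MeasurableSet[n ⊔ mE] (C ∩ A) :=
    MeasurableSet.inter (le_sup_left (a := n) (b := mE) C hC)
      (le_sup_right (a := n) (b := mE) A hA)
  -- The pivot is the integral over `C` of the product of the two conditional probabilities, which
  -- is symmetric in `A` and `B`.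
  calc ∫ ω in C ∩ B, (μ⟦A | n⟧) ω ∂μ
      = ∫ ω in C, (μ⟦A | n⟧) ω * (μ⟦B | n⟧) ω ∂μ :=
        (setIntegral_mul_condExp_indicator hn hC (hF B hB) stronglyMeasurable_condExp
          integrable_condExp).symm
    _ = ∫ ω in C, (μ⟦B | n⟧) ω * (μ⟦A | n⟧) ω ∂μ := by simp_rw [mul_comm]
    _ = ∫ ω in C ∩ A, (μ⟦B | n⟧) ω ∂μ :=
        setIntegral_mul_condExp_indicator hn hC (hE A hA) stronglyMeasurable_condExp
          integrable_condExp
    _ = ∫ ω in C ∩ A, (μ⟦B | n ⊔ mE⟧) ω ∂μ :=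
        setIntegral_congr_ae (sup_le hn hE _ hCA) ((h B hB).mono fun ω hω _ => hω.symm)
    _ = ∫ ω in C ∩ A, B.indicator (fun _ => (1 : ℝ)) ω ∂μ :=
        setIntegral_condExp (sup_le hn hE) (integrable_indicator_one (hF B hB)) hCA
    _ = ∫ ω in C ∩ B, A.indicator (fun _ => (1 : ℝ)) ω ∂μ := by
        rw [setIntegral_indicator (hF B hB), setIntegral_indicator (hE A hA),
          Set.inter_right_comm]

/-- A conditional expectation that is measurable for a smaller σ-algebra is also the conditional
expectation for every σ-algebra in between. -/
theorem condExp_eq_of_le_of_le {f g : Ω → ℝ} (h₁ : n ≤ n')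
    (h₂ : n' ≤ n'') (h₃ : n'' ≤ m₀) (hg : StronglyMeasurable[n] g) (hgi : Integrable g μ)
    (h : μ[f | n''] =ᵐ[μ] g) : μ[f | n'] =ᵐ[μ] g := by
  have h' := condExp_of_stronglyMeasurable (μ := μ) (h₂.trans h₃) (hg.mono h₁) hgi
  exact (condExp_condExp_of_le h₂ h₃).symm.trans ((condExp_congr_ae h).trans (by rw [h']))

/-- If `E` is independent of `F`, `U` is a function of `F`, and `X` is a function of `U` and `E`,
then `E` and `F` are conditionally independent given `U` and `X`. -/
theorem condExp_sup_eq_of_indep [IsProbabilityMeasure μ] (hE : mE ≤ m₀) (hF : mF ≤ m₀)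
    (hind : Indep mE mF μ) (hU : mU ≤ mF) (hX : mX ≤ mU ⊔ mE) {A : Set Ω}
    (hA : MeasurableSet[mE] A) : μ⟦A | mU ⊔ mX ⊔ mF⟧ =ᵐ[μ] μ⟦A | mU ⊔ mX⟧ := by
  have hU₀ : mU ≤ m₀ := hU.trans hF
  have hUE : mU ⊔ mE ≤ m₀ := sup_le hU₀ hE
  have hle : mU ⊔ mX ≤ mU ⊔ mE := sup_le le_sup_left hX
  -- By independence, the probability of `A` given either `mF` or `mU` is the constant `μ A`;
  -- symmetry then exchanges the roles of `mE` and `mF`.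
  have hB : ∀ B, MeasurableSet[mF] B → μ⟦B | mU ⊔ mE⟧ =ᵐ[μ] μ⟦B | mU⟧ := by
    intro B hB
    refine condExp_sup_eq_symm hU₀ hF hE (fun A hA => ?_) hB
    rw [sup_eq_right.2 hU]
    have hAm : StronglyMeasurable[mE] (A.indicator fun _ => (1 : ℝ)) :=
      stronglyMeasurable_const.indicator hA
    exact (condExp_indep_eq hE hF hAm hind).trans
      (condExp_indep_eq hE hU₀ hAm (indep_of_indep_of_le_right hind hU)).symm
  -- After a second exchange, `mX` is harmless: it is absorbed by `mU ⊔ mE`, and `mU ⊔ mX` lies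
  -- between `mU` and `mU ⊔ mE`.
  refine condExp_sup_eq_symm (hle.trans hUE) hE hF (fun B hBm => ?_) hA
  have hsup : mU ⊔ mX ⊔ mE = mU ⊔ mE :=
    le_antisymm (sup_le hle le_sup_right) (sup_le_sup_right le_sup_left _)
  rw [hsup]
  exact (hB B hBm).trans (condExp_eq_of_le_of_le le_sup_left hle hUE stronglyMeasurable_condExp
    integrable_condExp (hB B hBm)).symm

/-- If the conditional probabilities of the events of `m₁` given `n''` are measurable for `n`, then
`m₁` and `m₂` are conditionally independent given any `n'` between `n` and `n''`. -/
theorem condIndep_of_condExp_eq [StandardBorelSpace Ω]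
    (h₁ : n ≤ n') (h₂ : n' ≤ n'') (h₃ : n'' ≤ m₀) (hm₁ : m₁ ≤ m₀) (hm₂ : m₂ ≤ n'')
    (h : ∀ A, MeasurableSet[m₁] A → μ⟦A | n''⟧ =ᵐ[μ] μ⟦A | n⟧) :
    CondIndep n' m₁ m₂ (h₂.trans h₃) μ := by
  rw [condIndep_iff _ _ _ _ hm₁ (hm₂.trans h₃)]
  intro A B hA hB
  have hB₀ : MeasurableSet B := h₃ B (hm₂ B hB)
  have hBs : StronglyMeasurable[n''] (B.indicator fun _ => (1 : ℝ)) :=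
    stronglyMeasurable_const.indicator (hm₂ B hB)
  have hAB : ((A ∩ B).indicator fun _ => (1 : ℝ)) =
      (A.indicator fun _ => (1 : ℝ)) * B.indicator fun _ => (1 : ℝ) := by
    ext ω
    by_cases hωA : ω ∈ A <;> by_cases hωB : ω ∈ B <;> simp [hωA, hωB]
  have hABi : Integrable ((A.indicator fun _ => (1 : ℝ)) * B.indicator fun _ => (1 : ℝ)) μ :=
    hAB ▸ integrable_indicator_one ((hm₁ A hA).inter hB₀)
  have hpull : μ⟦A ∩ B | n''⟧ =ᵐ[μ] μ⟦A | n⟧ * B.indicator fun _ => (1 : ℝ) := by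
    rw [hAB]
    exact (condExp_mul_of_stronglyMeasurable_right hBs hABi
      (integrable_indicator_one (hm₁ A hA))).trans ((h A hA).mul Filter.EventuallyEq.rfl)
  have hint : Integrable (μ⟦A | n⟧ * B.indicator fun _ => (1 : ℝ)) μ :=
    integrable_condExp.congr hpull
  have hA' : μ⟦A | n'⟧ =ᵐ[μ] μ⟦A | n⟧ :=
    condExp_eq_of_le_of_le h₁ h₂ h₃ stronglyMeasurable_condExp integrable_condExp (h A hA)
  -- Tower property from `n''` down to `n'`, where the `n`-measurable factor is pulled out.
  exact (condExp_condExp_of_le h₂ h₃).symm.trans <| (condExp_congr_ae hpull).trans <|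
    (condExp_mul_of_stronglyMeasurable_left (stronglyMeasurable_condExp.mono h₁) hint
      (integrable_indicator_one hB₀)).trans (hA'.symm.mul Filter.EventuallyEq.rfl)

end CondExp

/-! ### Markov blankets and d-separation in the augmented graph. -/

namespace CausalGraph

variable {ι : Type*} {G : Digraph ι}

@[simp] theorem augmented_adj_inl_inl {i j : ι} :
    (augmented G).Adj (.inl i) (.inl j) ↔ G.Adj i j := Iff.rfl

@[simp] theorem augmented_adj_inr_inl {i j : ι} :
    (augmented G).Adj (.inr i) (.inl j) ↔ i = j := Iff.rfl

@[simp] theorem not_augmented_adj_inr {a : ι ⊕ ι} {j : ι} :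
    ¬ (augmented G).Adj a (.inr j) := by
  cases a <;> exact id

theorem mem_exoMarkovBlanket {i j : ι} : j ∈ exoMarkovBlanket G i ↔ j = i ∨ G.Adj j i := by
  simp [exoMarkovBlanket, markovBlanket, children, parents, spouses, eq_comm]

theorem IsDAG.not_adj_self (hG : IsDAG G) (i : ι) : ¬ G.Adj i i :=
  fun h => hG i (.single h)

theorem IsDAG.asymm (hG : IsDAG G) {i j : ι} (h : G.Adj i j) : ¬ G.Adj j i :=
  fun h' => hG i (.tail (.single h) h')

theorem IsDAG.wellFounded [Finite ι] (hG : IsDAG G) : WellFounded G.Adj := by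
  have : Std.Irrefl (Relation.TransGen G.Adj) := ⟨hG⟩
  exact Subrelation.wf Relation.TransGen.single
    (Finite.wellFounded_of_trans_of_irrefl (Relation.TransGen G.Adj))

theorem markovBlanket_inter_exoMarkovBlanket (i : ι) :
    markovBlanket G i ∩ exoMarkovBlanket G i = parents G i := by
  ext j
  rw [Set.mem_inter_iff, mem_exoMarkovBlanket]
  constructor
  · rintro ⟨hj, rfl | h⟩
    · rcases hj with (h | h) | h
      · exact h
      · exact h
      · exact absurd rfl h.1
    · exact h
  · exact fun h => ⟨.inl (.inr h), .inr h⟩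

/-- Given all other endogenous nodes, `e_i` and `x_j` are d-separated exactly if `x_j` is not a
parent of `x_i`. -/
theorem IsDAG.dSep_augmented_compl (hG : IsDAG G) {i j : ι} (hj : j ≠ i) :
    DSep (augmented G) {.inr i} {.inl j} (Sum.inl '' {j}ᶜ) ↔ ¬ G.Adj j i := by
  constructor
  · intro h hadj
    -- The trail `e_i → x_i ← x_j`, active because its collider `x_i` is conditioned on.
    refine h _ rfl _ rfl
      ⟨2, fun k => if k = 0 then .inr i else if k = 1 then .inl i else .inl j, rfl, rfl, ?_, ?_⟩
    · intro k hk
      interval_cases k <;> simp [hadj]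
    · intro k hk
      interval_cases k <;> simp [IsCollider, hadj, hj.symm]
  · rintro hadj _ rfl _ rfl ⟨n, p, hp0, hpn, htrail, hact⟩
    -- An active trail cannot leave `{e_i, x_i}`. At `x_i`, which is in the conditioning set, it
    -- must have a collider, so the next node is a parent of `x_i`. If that is some `x_l`, then `l ≠
    -- j`, so `x_l` must be a collider as well, forcing edges both ways between `x_i` and `x_l`.
    have key : ∀ k ≤ n, p k = .inr i ∨ p k = .inl i := by
      intro k
      induction k with
      | zero => exact fun _ => .inl hp0
      | succ k ih =>
        intro hk
        rcases ih (Nat.le_of_succ_le hk) with h | h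
        · have ht := htrail k hk
          rw [h] at ht
          rcases hq : p (k + 1) with l | l <;> simp_all
        · obtain ⟨-, -, -, hc⟩ := (hact k (Nat.le_of_succ_le hk)).1 (by simp [h, hj.symm])
          rw [h] at hc
          rcases hq : p (k + 1) with l | l
          · rw [hq, augmented_adj_inl_inl] at hc
            have hl : l ≠ j := fun hl => hadj (hl ▸ hc)
            obtain ⟨-, -, hc', -⟩ := (hact (k + 1) hk).1 (by simp [hq, hl])
            rw [Nat.add_sub_cancel, h, hq, augmented_adj_inl_inl] at hc'
            exact absurd hc' (hG.asymm hc)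
          · rw [hq, augmented_adj_inr_inl] at hc
            exact .inl (by rw [hc])
    rcases key n le_rfl with h | h
    · simp [hpn] at h
    · exact hj (Sum.inl_injective (hpn.symm.trans h))

end CausalGraph

/-! ### Dependence of structural functions on the parents only. -/

theorem Function.eq_of_forall_update_eq {κ : Type*} [Finite κ] [DecidableEq κ] {α : κ → Type*}
    {β : Type*} (F : (∀ k, α k) → β) (s : Set κ)
    (hF : ∀ k ∉ s, ∀ a v, F (Function.update a k v) = F a) {a b : ∀ k, α k}
    (hab : ∀ k ∈ s, a k = b k) : F a = F b := by
  have := Fintype.ofFinite κ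
  -- Coordinates of `a` are replaced by those of `b` one at a time.
  have key : ∀ t : Finset κ, F (t.piecewise b a) = F a := by
    intro t
    induction t using Finset.induction_on with
    | empty => simp
    | insert k t hk ih =>
      rw [Finset.piecewise_insert, ← ih]
      by_cases hks : k ∈ s
      · congr 1
        rw [Function.update_eq_self_iff, Finset.piecewise_eq_of_notMem _ _ _ hk, hab k hks]
      · exact hF k hks _ _
  simpa using (key Finset.univ).symm

namespace SCM

theorem measurable_f_comp {X : Type u} {Y : Type v} (M : SCM.{u, v, w} X Y) {Ω : Type*}
    {m : MeasurableSpace Ω} {x : X} {g : Ω → ∀ y : {y : X // y ≠ x}, M.DX y.1}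
    {h : Ω → ∀ e, M.DY e} (hg : ∀ y, Measurable fun ω => g ω y)
    (hh : ∀ e, Measurable fun ω => h ω e) : Measurable fun ω => M.f x (g ω) (h ω) :=
  (M.measurable_f x).comp ((measurable_pi_lambda _ hg).prodMk (measurable_pi_lambda _ hh))

section Congr

variable {X : Type u} {Y : Type v} [Finite X] [Finite Y] {M : SCM.{u, v, w} X Y}

/-- A structural function depends only on the parents. -/
theorem f_congr {x : X} {xs xs' : ∀ y : {y : X // y ≠ x}, M.DX y.1} {es es' : ∀ e, M.DY e}
    (hx : ∀ y, M.IsParent (.inl y.1) x → xs y = xs' y)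
    (he : ∀ e, M.IsParent (.inr e) x → es e = es' e) : M.f x xs es = M.f x xs' es' := by
  classical
  trans M.f x xs' es
  · refine Function.eq_of_forall_update_eq (fun a => M.f x a es)
      {y | M.IsParent (.inl y.1) x} (fun y hy a v => ?_) hx
    obtain ⟨f', hf'⟩ := not_not.1 hy
    -- Choosing the value of `x` to be that of `M.f` turns the equivalence of equations into an
    -- equality of functions.
    rw [(hf' _ _ _).1 rfl, (hf' _ a es).1 rfl]
    congr 1
    ext z
    exact Function.update_of_ne (fun h => z.2.2 (congrArg (fun y => Sum.inl y.1) h)) _ _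
  · refine Function.eq_of_forall_update_eq (fun a => M.f x xs' a)
      {e | M.IsParent (.inr e) x} (fun e hy a v => ?_) he
    obtain ⟨f', hf'⟩ := not_not.1 hy
    rw [(hf' _ _ _).1 rfl, (hf' _ _ a).1 rfl]
    congr 1
    ext z
    exact Function.update_of_ne (fun h => z.2 (congrArg Sum.inr h)) _ _

end Congr

/-! ### Measurability and conditional independence of the solution variables. -/

namespace Solution

section Measurable

variable {X : Type u} {Y : Type v} [Finite X] [Finite Y] {M : SCM.{u, v, w} X Y}
  {Ω : Type*} {m : MeasurableSpace Ω} [MeasurableSpace Ω] {μ : Measure Ω}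

/-- An endogenous variable is a measurable function of its parents. -/
theorem measurable_x_of_parents (S : M.Solution μ) {x : X}
    (hx : ∀ y, M.IsParent (.inl y) x → Measurable[m] (S.x y))
    (he : ∀ e, M.IsParent (.inr e) x → Measurable[m] (S.e e)) : Measurable[m] (S.x x) := by
  classical
  rcases isEmpty_or_nonempty Ω with hΩ | ⟨⟨ω₀⟩⟩
  · exact fun s _ => by
      rw [Set.eq_empty_of_isEmpty (S.x x ⁻¹' s)]
      exact @MeasurableSet.empty _ m
  -- Non-parents do not affect the value, so they are frozen at `ω₀`; only the parents then need to
  -- be `m`-measurable.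
  have heq : S.x x = fun ω => M.f x
      (fun y => if M.IsParent (.inl y.1) x then S.x y.1 ω else S.x y.1 ω₀)
      (fun e => if M.IsParent (.inr e) x then S.e e ω else S.e e ω₀) := by
    ext ω
    rw [S.eqn x ω]
    exact f_congr (fun y hy => (if_pos hy).symm) fun e he => (if_pos he).symm
  rw [heq]
  refine M.measurable_f_comp (fun y => ?_) fun e => ?_
  · by_cases hy : M.IsParent (.inl y.1) x
    · simpa only [if_pos hy] using hx y.1 hy
    · simpa only [if_neg hy] using measurable_const
  · by_cases hy : M.IsParent (.inr e) x
    · simpa only [if_pos hy] using he e hy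
    · simpa only [if_neg hy] using measurable_const

end Measurable

variable {ι : Type u} {M : SCM.{u, u, w} ι ι} {Ω : Type*} {m : MeasurableSpace Ω}
  [MeasurableSpace Ω] {μ : Measure Ω}

/-- The σ-algebra generated by the endogenous variables in `T`. -/
abbrev sigmaX (S : M.Solution μ) (T : Set ι) : MeasurableSpace Ω :=
  ⨆ k ∈ T, MeasurableSpace.comap (S.x k) inferInstance

/-- The σ-algebra generated by the exogenous variables in `T`. -/
abbrev sigmaE (S : M.Solution μ) (T : Set ι) : MeasurableSpace Ω :=
  ⨆ k ∈ T, MeasurableSpace.comap (S.e k) inferInstance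

variable (S : M.Solution μ) {T : Set ι} {k : ι}

theorem comap_x_le_sigmaX (hk : k ∈ T) :
    MeasurableSpace.comap (S.x k) inferInstance ≤ S.sigmaX T :=
  le_iSup₂_of_le k hk le_rfl

theorem comap_e_le_sigmaE (hk : k ∈ T) :
    MeasurableSpace.comap (S.e k) inferInstance ≤ S.sigmaE T :=
  le_iSup₂_of_le k hk le_rfl

theorem sigmaX_le (h : ∀ k ∈ T, MeasurableSpace.comap (S.x k) inferInstance ≤ m) :
    S.sigmaX T ≤ m :=
  iSup₂_le h

theorem sigmaE_le (T : Set ι) : S.sigmaE T ≤ ‹MeasurableSpace Ω› :=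
  iSup₂_le fun k _ => (S.measurable_e k).comap_le

theorem comap_pi_le_iff : MeasurableSpace.comap (fun ω (k : T) => S.x k.1 ω) inferInstance ≤ m ↔
    ∀ k ∈ T, MeasurableSpace.comap (S.x k) inferInstance ≤ m :=
  MeasurableSpace.comap_pi_le_iff.trans Subtype.forall

theorem indep_comap_e_sigmaE_compl (i : ι) :
    Indep (MeasurableSpace.comap (S.e i) inferInstance) (S.sigmaE {i}ᶜ) μ := by
  have h := indep_iSup_of_disjoint (fun k => (S.measurable_e k).comap_le) S.indep
    (Set.disjoint_singleton_left.2 (Set.notMem_compl_iff.2 (Set.mem_singleton i)))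
  rwa [iSup_singleton] at h

section Finite

variable [Finite ι]

/-- The inductive step for inductions along the edges of the DAG. -/
theorem comap_x_le_of_adj (hexo : M.HasMatchedExogenous)
    (hx : ∀ y, M.graph.Adj y k → MeasurableSpace.comap (S.x y) inferInstance ≤ m)
    (he : MeasurableSpace.comap (S.e k) inferInstance ≤ m) :
    MeasurableSpace.comap (S.x k) inferInstance ≤ m := by
  refine Measurable.comap_le (S.measurable_x_of_parents
    (fun y hy => Measurable.of_comap_le (hx y hy)) fun l hl => ?_)
  obtain rfl := (hexo k l).1 hl
  exact Measurable.of_comap_le he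

/-- The noise `e_i` enters only the equation of `x_i`, so it influences only `x_i` and its
descendants. -/
theorem comap_x_le_sigmaE_of_not_reach (hexo : M.HasMatchedExogenous)
    (hdag : CausalGraph.IsDAG M.graph) {i : ι} (hk : ¬ Relation.ReflTransGen M.graph.Adj i k) :
    MeasurableSpace.comap (S.x k) inferInstance ≤ S.sigmaE {i}ᶜ := by
  induction k using hdag.wellFounded.induction with
  | _ k ih =>
    exact S.comap_x_le_of_adj hexo (fun y hy => ih y hy fun h => hk (h.tail hy))
      (S.comap_e_le_sigmaE fun h => hk (h ▸ .refl))

/-- Once `x_i` is given, its equation, the only one containing `e_i`, need not be solved. -/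
theorem comap_x_le_sup_sigmaE (hexo : M.HasMatchedExogenous)
    (hdag : CausalGraph.IsDAG M.graph) (i k : ι) :
    MeasurableSpace.comap (S.x k) inferInstance ≤
      MeasurableSpace.comap (S.x i) inferInstance ⊔ S.sigmaE {i}ᶜ := by
  induction k using hdag.wellFounded.induction with
  | _ k ih =>
    rcases eq_or_ne k i with rfl | hk
    · exact le_sup_left
    · exact S.comap_x_le_of_adj hexo ih ((S.comap_e_le_sigmaE hk).trans le_sup_right)

/-- An endogenous variable that is not a parent of `x_i` is conditionally independent of `e_i`
given all other endogenous variables. -/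
theorem condIndep_compl_of_not_adj [StandardBorelSpace Ω] [IsProbabilityMeasure μ]
    (hexo : M.HasMatchedExogenous) (hdag : CausalGraph.IsDAG M.graph)
    {i j : ι} (hj : j ≠ i) (hadj : ¬ M.graph.Adj j i) : S.CondIndep i j {j}ᶜ := by
  have hE := (S.measurable_e i).comap_le
  have hF := S.sigmaE_le {i}ᶜ
  -- By acyclicity, a parent of `x_i` is not reachable from `x_i`.
  have hU : S.sigmaX {k | M.graph.Adj k i} ≤ S.sigmaE {i}ᶜ := S.sigmaX_le fun k hk =>
    S.comap_x_le_sigmaE_of_not_reach hexo hdag fun h => hdag i (.tail' h hk)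
  have hX := S.comap_x_le_of_adj hexo
    (fun y hy => (S.comap_x_le_sigmaX (T := {k | M.graph.Adj k i}) hy).trans
      (le_sup_left (b := MeasurableSpace.comap (S.e i) inferInstance))) le_sup_right
  have hall : ∀ k, MeasurableSpace.comap (S.x k) inferInstance ≤
      S.sigmaX {k | M.graph.Adj k i} ⊔ MeasurableSpace.comap (S.x i) inferInstance ⊔
        S.sigmaE {i}ᶜ :=
    fun k => (S.comap_x_le_sup_sigmaE hexo hdag i k).trans (sup_le_sup_right le_sup_right _)
  have hZ := (S.comap_pi_le_iff (T := {j}ᶜ)).1 le_rfl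
  -- The chain is `n = σ(U, x_i)`, `n' = σ(x_k, k ≠ j)`, `n'' = σ(U, x_i, F)`. The first inclusion
  -- is where `x_j` must be neither `x_i` nor a parent of it.
  exact condIndep_of_condExp_eq
    (sup_le (S.sigmaX_le fun k hk => hZ k fun h => hadj (h ▸ hk)) (hZ i hj.symm))
    (S.comap_pi_le_iff.2 fun k _ => hall k)
    (sup_le (sup_le (hU.trans hF) (S.measurable_x i).comap_le) hF) hE (hall j)
    fun A hA => condExp_sup_eq_of_indep hE hF (S.indep_comap_e_sigmaE_compl i) hU hX hA

variable {S}

/-- A DAG whose augmented graph represents the conditional independencies of a faithful model has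
the same edges as the model. -/
theorem IsRepresentedBy.adj_iff [StandardBorelSpace Ω] [IsProbabilityMeasure μ]
    (hexo : M.HasMatchedExogenous) (hdag : CausalGraph.IsDAG M.graph)
    (hfaith : S.IsFaithfulTo M.graph) {G : Digraph ι} (hG : CausalGraph.IsDAG G)
    (hrep : S.IsRepresentedBy G) {i j : ι} : G.Adj j i ↔ M.graph.Adj j i := by
  rcases eq_or_ne j i with rfl | hj
  · exact iff_of_false (hG.not_adj_self j) (hdag.not_adj_self j)
  have hjZ : j ∉ ({j}ᶜ : Set ι) := Set.notMem_compl_iff.2 (Set.mem_singleton j)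
  rw [← not_iff_not, ← hG.dSep_augmented_compl hj, ← hrep i j _ hjZ]
  -- Faithfulness gives one direction, the structural equations the other.
  exact ⟨fun h => (hdag.dSep_augmented_compl hj).1 (hfaith i j _ hjZ h),
    S.condIndep_compl_of_not_adj hexo hdag hj⟩

end Finite

end Solution

end SCM

theorem mainTheorem1 {ι : Type u} [Finite ι] (M : SCM.{u, u, w} ι ι)
    (hexo : M.HasMatchedExogenous) (hdag : CausalGraph.IsDAG M.graph) :
    -- in the augmented graph of the model's own DAG
    ((∀ i j : ι, j ≠ i →
        (j ∈ CausalGraph.exoMarkovBlanket M.graph i ↔ M.IsParent (Sum.inl j) i)) ∧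
      ∀ i : ι, CausalGraph.markovBlanket M.graph i ∩ CausalGraph.exoMarkovBlanket M.graph i =
        {j | M.IsParent (Sum.inl j) i}) ∧
    -- in every augmented graph that represents the joint law, when the model is faithful
    ∀ (Ω : Type v) [MeasurableSpace Ω] [StandardBorelSpace Ω] (μ : Measure Ω)
      [IsProbabilityMeasure μ] (S : M.Solution μ), S.IsFaithfulTo M.graph →
      ∀ G : Digraph ι, CausalGraph.IsDAG G → S.IsRepresentedBy G →
        (∀ i j : ι, j ≠ i →
          (j ∈ CausalGraph.exoMarkovBlanket G i ↔ M.IsParent (Sum.inl j) i)) ∧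
        ∀ i : ι, CausalGraph.markovBlanket G i ∩ CausalGraph.exoMarkovBlanket G i =
          {j | M.IsParent (Sum.inl j) i} := by
  have key : ∀ G : Digraph ι, (∀ i j, G.Adj j i ↔ M.graph.Adj j i) →
      (∀ i j : ι, j ≠ i →
        (j ∈ CausalGraph.exoMarkovBlanket G i ↔ M.IsParent (Sum.inl j) i)) ∧
      ∀ i : ι, CausalGraph.markovBlanket G i ∩ CausalGraph.exoMarkovBlanket G i =
        {j | M.IsParent (Sum.inl j) i} := by
    refine fun G hadj => ⟨fun i j hj => ?_, fun i => ?_⟩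
    · rw [CausalGraph.mem_exoMarkovBlanket, or_iff_right hj]
      exact hadj i j
    · rw [CausalGraph.markovBlanket_inter_exoMarkovBlanket]
      exact Set.ext fun j => hadj i j
  exact ⟨key _ fun _ _ => Iff.rfl, fun Ω _ _ μ _ S hfaith G hG hrep =>
    key G fun _ _ => hrep.adj_iff hexo hdag hfaith hG⟩
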